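/- Let $n$ and $k$ be integers with $1\le k<n$ and let $\epsilon>0$. Then there is a real number $a_0$, depending only on $n$, $k$ and $\epsilon$, such that for all real $a>a_0$ and all real $b$ with \[ 0<b<\left(\frac{n-k}{n+k}-\epsilon\right)a , \] the function \[ f(z)=z^n+az^k+b\overline{z}^{\,k}-1\qquad(z\in\mathbb{C}) \] has exactly $n$ zeros in $\mathbb{C}$, both as distinct points and counted with multiplicity, and none of them lies in the sense-reversing region or on the critical curve of $f$. Here, with $h(z)=z^n+az^k-1$ and $g(z)=bz^k$, so that $f=h+\overline{g}$, the sense-preserving region, the sense-reversing region and the critical curve of $f$ are the sets of $z\in\mathbb{C}$ with $|h'(z)|>|g'(z)|$, $|h'(z)|<|g'(z)|$ and $|h'(z)|=|g'(z)|$, respectively. The order of a zero in the sense-preserving region is the least $m\ge1$ with $h^{(m)}(z)\ne0$, in the sense-reversing region it is $-m$ with $m\ge 1$ least such that $g^{(m)}(z)\neq 0$; the multiplicity of a zero is the absolute value of its order. -/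

import Mathlib

/-- The harmonic function `f(z) = z^n + a z^k + b (conj z)^k - 1`. -/
noncomputable def harmonicF (n k : ℕ) (a b : ℝ) (z : ℂ) : ℂ :=
  z ^ n + (a : ℂ) * z ^ k + (b : ℂ) * (starRingEnd ℂ z) ^ k - 1

/-- The function `h(z) = z^n + a z^k - 1`, the analytic part of `f = h + conj g`. -/
noncomputable def analyticPart (n k : ℕ) (a : ℝ) (z : ℂ) : ℂ :=
  z ^ n + (a : ℂ) * z ^ k - 1

/-- The function `g(z) = b z^k`, whose conjugate is the co-analytic part of `f = h + conj g`. -/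
noncomputable def coanalyticPart (k : ℕ) (b : ℝ) (z : ℂ) : ℂ :=
  (b : ℂ) * z ^ k

theorem harmonicF_eq (n k : ℕ) (a b : ℝ) (z : ℂ) :
    harmonicF n k a b z = analyticPart n k a z + starRingEnd ℂ (coanalyticPart k b z) := by
  simp only [harmonicF, analyticPart, coanalyticPart, map_mul, map_pow, Complex.conj_ofReal]
  ring

/-- The sense-preserving region of `h + conj g`: the points where `|h'| > |g'|`. -/
def sensePreservingRegion (h g : ℂ → ℂ) : Set ℂ :=
  {z | ‖deriv g z‖ < ‖deriv h z‖}

/-- The sense-reversing region of `h + conj g`: the points where `|h'| < |g'|`. -/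
def senseReversingRegion (h g : ℂ → ℂ) : Set ℂ :=
  {z | ‖deriv h z‖ < ‖deriv g z‖}

/-- The critical curve of `h + conj g`: the points where `|h'| = |g'|`. -/
def criticalCurve (h g : ℂ → ℂ) : Set ℂ :=
  {z | ‖deriv h z‖ = ‖deriv g z‖}

open Classical in
/-- The order of a zero `z` of `h + conj g`: in the sense-preserving region, the least `m ≥ 1` with
`h^(m)(z) ≠ 0`; in the sense-reversing region, `-m` for the least `m ≥ 1` with `g^(m)(z) ≠ 0`.
(In both cases such an `m` exists, namely `m = 1`.) Points of the critical curve have no order;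
they get the default value `0`. -/
noncomputable def zeroOrder (h g : ℂ → ℂ) (z : ℂ) : ℤ :=
  if z ∈ sensePreservingRegion h g then
    ((sInf {m : ℕ | 1 ≤ m ∧ iteratedDeriv m h z ≠ 0} : ℕ) : ℤ)
  else if z ∈ senseReversingRegion h g then
    -((sInf {m : ℕ | 1 ≤ m ∧ iteratedDeriv m g z ≠ 0} : ℕ) : ℤ)
  else 0

/-- The set of zeros of `f` in the plane. -/
def zeroSet (n k : ℕ) (a b : ℝ) : Set ℂ :=
  {z | harmonicF n k a b z = 0}

/-!
The number of zeros of `f = h + conj g` is computed by a continuation in `b`, starting from the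
polynomial case `b = 0`; no argument principle for harmonic functions is needed.

With `a₀ = n / ε`, every zero of `f` is sense-preserving, for each value of the parameter between
`0` and `b` (`mem_sensePreservingRegion_of_harmonicF_eq_zero`). Indeed, after division by
`|z|^(k-1)`, the inequality `|h'| > |g'|` reads `|n z^(n-k) + k a| > k b`. If `|z| ≤ 1`, this is clear
because `k (a - b) > n`. If `|z| > 1`, the equation `f z = 0` gives `z^(n-k) = -a - b u + z^(-k)` with
`|u| = 1`, so that the left side is at least `(n - k) a - n b - n`, which exceeds `k b` as
`(n - k) a - (n + k) b ≥ (n + k) ε a > n`.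

At a sense-preserving zero the real differential `v ↦ h' v + conj (g' v)` of `f` is injective. By
the implicit function theorem the zero continues uniquely to nearby parameters, and as the zeros
stay in a compact set, no others appear: the number of zeros is finite and locally constant in the
parameter (`zeroSet_finite_and_eventually_ncard_eq`), hence constant on `[0, b]`. At `b = 0` it is
the number of roots of `X^n + a X^k - 1`. They are simple because `h' ≠ 0` there, so there are `n`
of them (`ncard_zeroSet_zero`). Finally, `h' ≠ 0` also says that each zero has order `1`.
-/

/-! ### Cardinality of the fibres of a closed set over a parameter space -/

open Filter Topology in
/-- If a closed subset `Z` of `X × Y` is locally, at each point over `x₀`, the graph of a function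
of the parameter, and if its fibres over a neighbourhood of `x₀` lie in one compact set, then the
fibre over `x₀` is finite and nearby fibres have the same number of points. -/
theorem fiber_finite_and_eventually_ncard_eq {X Y : Type*} [TopologicalSpace X]
    [TopologicalSpace Y] [T2Space Y] {Z : Set (X × Y)} (hZ : IsClosed Z) (x₀ : X) {K : Set Y}
    (hK : IsCompact K) (hKZ : ∀ᶠ x in 𝓝 x₀, ∀ y, (x, y) ∈ Z → y ∈ K)
    (hψ : ∀ y, (x₀, y) ∈ Z → ∃ ψ : X → Y, Tendsto ψ (𝓝 x₀) (𝓝 y) ∧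
      ∀ᶠ p in 𝓝 (x₀, y), p ∈ Z ↔ ψ p.1 = p.2) :
    {y | (x₀, y) ∈ Z}.Finite ∧
      ∀ᶠ x in 𝓝 x₀, {y | (x, y) ∈ Z}.ncard = {y | (x₀, y) ∈ Z}.ncard := by
  have hfin : {y | (x₀, y) ∈ Z}.Finite := by
    by_contra hinf
    obtain ⟨y, -, hy⟩ := Set.Infinite.exists_accPt_of_subset_isCompact hinf hK
      (fun y hy => hKZ.self_of_nhds y hy)
    rw [accPt_iff_frequently] at hy
    have hc : Tendsto (fun w : Y => (x₀, w)) (𝓝 y) (𝓝 (x₀, y)) :=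
      (Continuous.prodMk_right x₀).tendsto y
    by_cases hyZ : (x₀, y) ∈ Z
    · obtain ⟨ψ, -, hψe⟩ := hψ y hyZ
      have h0 : ψ x₀ = y := hψe.self_of_nhds.1 hyZ
      refine hy ?_
      filter_upwards [hc.eventually hψe] with w hw hw'
      exact hw'.1 ((hw.1 hw'.2).symm.trans h0)
    · refine hy ?_
      filter_upwards [hc.eventually (hZ.isOpen_compl.eventually_mem hyZ)] with w hw hw'
      exact hw hw'.2
  refine ⟨hfin, ?_⟩
  have hψ' : ∀ y, ∃ ψ : X → Y, (x₀, y) ∈ Z → Tendsto ψ (𝓝 x₀) (𝓝 y) ∧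
      ∀ᶠ p in 𝓝 (x₀, y), p ∈ Z ↔ ψ p.1 = p.2 := fun y => by
    classical exact
    if hy : (x₀, y) ∈ Z then (hψ y hy).imp fun _ h _ => h else ⟨fun _ => y, fun h => absurd h hy⟩
  choose ψ hψ' using hψ'
  have hψt := fun y hy => (hψ' y hy).1
  have hψe := fun y hy => (hψ' y hy).2
  -- The branches through the points of the fibre over `x₀` stay in `Z`,
  have h1 : ∀ᶠ x in 𝓝 x₀, ∀ y ∈ {y | (x₀, y) ∈ Z}, (x, ψ y x) ∈ Z := by
    rw [eventually_all_finite hfin]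
    intro y hy
    have : Tendsto (fun x => (x, ψ y x)) (𝓝 x₀) (𝓝 (x₀, y)) :=
      tendsto_id.prodMk_nhds (hψt y hy)
    filter_upwards [this.eventually (hψe y hy)] with x hx
    exact hx.2 rfl
  -- and they stay apart from each other
  have h2 : ∀ᶠ x in 𝓝 x₀, ∀ y ∈ {y | (x₀, y) ∈ Z}, ∀ y' ∈ {y | (x₀, y) ∈ Z},
      ψ y x = ψ y' x → y = y' := by
    rw [eventually_all_finite hfin]
    intro y hy
    rw [eventually_all_finite hfin]
    intro y' hy'
    by_cases hyy : y = y'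
    · exact .of_forall fun _ _ => hyy
    · filter_upwards [((hψt y hy).prodMk_nhds (hψt y' hy')).eventually
        (isClosed_diagonal.isOpen_compl.eventually_mem hyy)] with x hx hx'
      exact absurd hx' hx
  -- by compactness, there are no other points in the nearby fibres
  have h3 : ∀ᶠ x in 𝓝 x₀, ∀ w ∈ K, (x, w) ∈ Z → ∃ y, (x₀, y) ∈ Z ∧ ψ y x = w := by
    refine hK.eventually_forall_of_forall_eventually fun w _ => ?_
    by_cases hw : (x₀, w) ∈ Z
    · filter_upwards [hψe w hw] with p hp hpZ
      exact ⟨w, hw, hp.1 hpZ⟩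
    · filter_upwards [hZ.isOpen_compl.eventually_mem hw] with p hp hpZ
      exact absurd hpZ hp
  filter_upwards [h1, h2, h3, hKZ] with x h1 h2 h3 hKx
  refine (Set.ncard_congr (fun y _ => ψ y x) h1 (fun y y' hy hy' h => h2 y hy y' hy' h) ?_).symm
  intro w hw
  obtain ⟨y, hy, hyw⟩ := h3 w (hKx w hw) hw
  exact ⟨y, hy, hyw⟩

/-! ### The differential of the harmonic function -/

theorem hasDerivAt_analyticPart (n k : ℕ) (a : ℝ) (z : ℂ) :
    HasDerivAt (analyticPart n k a) (n * z ^ (n - 1) + a * (k * z ^ (k - 1))) z := by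
  unfold analyticPart
  exact ((hasDerivAt_pow n z).add ((hasDerivAt_pow k z).const_mul (a : ℂ))).sub_const 1

theorem hasDerivAt_coanalyticPart (k : ℕ) (b : ℝ) (z : ℂ) :
    HasDerivAt (coanalyticPart k b) (b * (k * z ^ (k - 1))) z := by
  unfold coanalyticPart
  exact (hasDerivAt_pow k z).const_mul (b : ℂ)

theorem contDiff_harmonicF (n k : ℕ) (a : ℝ) :
    ContDiff ℝ 1 (fun p : ℝ × ℂ => harmonicF n k a p.1 p.2) := by
  have h1 : ContDiff ℝ 1 (fun p : ℝ × ℂ => (p.1 : ℂ)) :=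
    Complex.ofRealCLM.contDiff.comp contDiff_fst
  have h2 : ContDiff ℝ 1 (fun p : ℝ × ℂ => starRingEnd ℂ p.2) :=
    Complex.conjCLE.contDiff.comp contDiff_snd
  unfold harmonicF
  exact (((contDiff_snd.pow n).add (contDiff_const.mul (contDiff_snd.pow k))).add
    (h1.mul (h2.pow k))).sub contDiff_const

/-- The partial differential of `f` in `z`, with `b` as the other variable, is
`v ↦ h' v + conj (g' v)`. -/
theorem fderiv_harmonicF_comp_inr (n k : ℕ) (a b : ℝ) (z v : ℂ) :
    (fderiv ℝ (fun p : ℝ × ℂ => harmonicF n k a p.1 p.2) (b, z) ∘L .inr ℝ ℝ ℂ) v =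
      deriv (analyticPart n k a) z * v +
        starRingEnd ℂ (deriv (coanalyticPart k b) z * v) := by
  have h1 : HasFDerivAt (harmonicF n k a b)
      (fderiv ℝ (fun p : ℝ × ℂ => harmonicF n k a p.1 p.2) (b, z) ∘L .inr ℝ ℝ ℂ) z := by
    have := (((contDiff_harmonicF n k a).differentiable one_ne_zero) (b, z)).hasFDerivAt
    exact this.comp z (hasFDerivAt_prodMk_right b z)
  have hh := (hasDerivAt_analyticPart n k a z).differentiableAt.hasDerivAt
    |>.hasFDerivAt.restrictScalars ℝ
  have hg := (hasDerivAt_coanalyticPart k b z).differentiableAt.hasDerivAt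
    |>.hasFDerivAt.restrictScalars ℝ
  have h2 := hh.add ((Complex.conjCLE.toContinuousLinearMap.hasFDerivAt
    (x := coanalyticPart k b z)).comp z hg)
  have h3 : HasFDerivAt (harmonicF n k a b) _ z :=
    h2.congr_of_eventuallyEq (.of_forall fun w => harmonicF_eq n k a b w)
  rw [h1.unique h3]
  simp [mul_comm]

/-- At a sense-preserving point the partial differential in `z` is invertible: it is injective, since
`h' v = -conj (g' v)` with `v ≠ 0` would force `|h'| = |g'|`. -/
theorem isInvertible_of_mem_sensePreservingRegion {n k : ℕ} {a b : ℝ} {z : ℂ}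
    (hz : z ∈ sensePreservingRegion (analyticPart n k a) (coanalyticPart k b)) :
    (fderiv ℝ (fun p : ℝ × ℂ => harmonicF n k a p.1 p.2) (b, z) ∘L
      .inr ℝ ℝ ℂ).IsInvertible := by
  set A := fderiv ℝ (fun p : ℝ × ℂ => harmonicF n k a p.1 p.2) (b, z) ∘L
    .inr ℝ ℝ ℂ with hA
  have hinj : Function.Injective A.toLinearMap := by
    rw [injective_iff_map_eq_zero]
    intro v hv
    by_contra hv0
    have hv : A v = 0 := hv
    rw [hA, fderiv_harmonicF_comp_inr, add_eq_zero_iff_eq_neg] at hv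
    have := congrArg norm hv
    rw [norm_neg, RCLike.norm_conj, norm_mul, norm_mul] at this
    exact (mul_right_cancel₀ (norm_ne_zero_iff.2 hv0) this).not_gt hz
  refine ⟨(LinearEquiv.ofInjectiveEndo _ hinj).toContinuousLinearEquiv, ?_⟩
  rfl

/-! ### Location of the zeros -/

theorem norm_le_of_harmonicF_eq_zero {n k : ℕ} (hkn : k < n) {a b : ℝ} {z : ℂ}
    (hz : harmonicF n k a b z = 0) : ‖z‖ ≤ |a| + |b| + 1 := by
  rcases le_total ‖z‖ 1 with h | h
  · linarith [abs_nonneg a, abs_nonneg b]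
  have h1 : z ^ n = 1 - a * z ^ k - b * (starRingEnd ℂ z) ^ k := by
    unfold harmonicF at hz; linear_combination hz
  have h2 : ‖z‖ ^ n ≤ 1 + |a| * ‖z‖ ^ k + |b| * ‖z‖ ^ k := by
    rw [← norm_pow, h1]
    refine (norm_sub_le _ _).trans (add_le_add ((norm_sub_le _ _).trans ?_) ?_) <;> simp
  have h3 : 1 ≤ ‖z‖ ^ k := one_le_pow₀ h
  have h4 : ‖z‖ ^ k * ‖z‖ ≤ ‖z‖ ^ n := by
    rw [← pow_succ]; exact pow_le_pow_right₀ h hkn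
  have h5 : ‖z‖ ^ k * ‖z‖ ≤ ‖z‖ ^ k * (|a| + |b| + 1) := by nlinarith
  exact le_of_mul_le_mul_left h5 (by linarith)

/-- For `a > n / ε` all zeros are sense-preserving. The value `b = 0` is included, as the starting
point of the continuation. -/
theorem mem_sensePreservingRegion_of_harmonicF_eq_zero {n k : ℕ} (hk : 1 ≤ k) (hkn : k < n)
    {ε a b : ℝ} (hε : 0 < ε) (ha : n / ε < a) (hb : 0 ≤ b)
    (hba : b ≤ (((n : ℝ) - k) / (n + k) - ε) * a) {z : ℂ} (hz : harmonicF n k a b z = 0) :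
    z ∈ sensePreservingRegion (analyticPart n k a) (coanalyticPart k b) := by
  have hk' : (1 : ℝ) ≤ k := by exact_mod_cast hk
  have hkn' : (k : ℝ) < n := by exact_mod_cast hkn
  have hεa : (n : ℝ) < ε * a := by rwa [div_lt_iff₀' hε] at ha
  have ha0 : 0 < a := by
    by_contra! h; nlinarith
  -- The hypothesis on `b`, cleared of denominators
  have hgap : ((n : ℝ) + k) * (ε * a) ≤ (n - k) * a - (n + k) * b := by
    have h := mul_le_mul_of_nonneg_left hba (by linarith : (0 : ℝ) ≤ n + k)
    have h' : ((n : ℝ) + k) * ((((n : ℝ) - k) / (n + k) - ε) * a) =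
        (n - k) * a - (n + k) * (ε * a) := by
      have : (n : ℝ) + k ≠ 0 := by linarith
      field_simp
    linarith
  have hz0 : z ≠ 0 := by
    rintro rfl
    simp [harmonicF, show n ≠ 0 by omega, show k ≠ 0 by omega] at hz
  have hr : 0 < ‖z‖ := norm_pos_iff.2 hz0
  have hpow : z ^ n = z ^ (n - k) * z ^ k := by rw [← pow_add]; congr 1; omega
  have hpow' : z ^ (n - 1) = z ^ (n - k) * z ^ (k - 1) := by rw [← pow_add]; congr 1; omega
  suffices key : b * k < ‖(n : ℂ) * z ^ (n - k) + a * k‖ by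
    change ‖deriv (coanalyticPart k b) z‖ < ‖deriv (analyticPart n k a) z‖
    rw [(hasDerivAt_coanalyticPart k b z).deriv, (hasDerivAt_analyticPart n k a z).deriv, hpow',
      show (n : ℂ) * (z ^ (n - k) * z ^ (k - 1)) + a * (k * z ^ (k - 1)) =
        (n * z ^ (n - k) + a * k) * z ^ (k - 1) by ring, ← mul_assoc, norm_mul, norm_mul,
      norm_mul]
    refine mul_lt_mul_of_pos_right ?_ (norm_pos_iff.2 (pow_ne_zero _ hz0))
    simpa [abs_of_nonneg hb] using key
  rcases le_or_gt (‖z‖ ^ k) 1 with hle | hgt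
  · -- In the unit disc the term `a * k` dominates
    have hz1 : ‖z‖ ≤ 1 := (pow_le_one_iff_of_nonneg hr.le (by omega)).1 hle
    have h1 : ‖(a : ℂ) * k‖ ≤ ‖(n : ℂ) * z ^ (n - k) + a * k‖ + ‖(n : ℂ) * z ^ (n - k)‖ := by
      simpa using norm_sub_le ((n : ℂ) * z ^ (n - k) + a * k) ((n : ℂ) * z ^ (n - k))
    have h2 : ‖(n : ℂ) * z ^ (n - k)‖ ≤ n := by
      rw [norm_mul, norm_pow, Complex.norm_natCast]
      exact mul_le_of_le_one_right (by linarith) (pow_le_one₀ hr.le hz1)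
    have h3 : ‖(a : ℂ) * k‖ = a * k := by simp [abs_of_pos ha0]
    have h4 : (n : ℝ) < a - b := by
      have : ((n : ℝ) + k) * (ε * a) ≤ (n + k) * (a - b) := by nlinarith
      linarith [le_of_mul_le_mul_left this (by linarith)]
    nlinarith
  · -- Outside it, eliminate `z ^ n` by the equation `f z = 0`; the constant `1` is then harmless
    have h1 : ((n - k : ℝ) : ℂ) * a * z ^ k =
        n - n * b * (starRingEnd ℂ z) ^ k - (n * z ^ (n - k) + a * k) * z ^ k := by
      unfold harmonicF at hz
      rw [hpow] at hz
      push_cast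
      linear_combination (n : ℂ) * hz
    have h2 : ((n : ℝ) - k) * a * ‖z‖ ^ k ≤
        n + n * b * ‖z‖ ^ k + ‖(n : ℂ) * z ^ (n - k) + a * k‖ * ‖z‖ ^ k := by
      calc ((n : ℝ) - k) * a * ‖z‖ ^ k = ‖((n - k : ℝ) : ℂ) * a * z ^ k‖ := by
            rw [norm_mul, norm_mul, norm_pow, Complex.norm_of_nonneg (by linarith),
              Complex.norm_of_nonneg ha0.le]
        _ ≤ ‖(n : ℂ)‖ + ‖(n : ℂ) * b * (starRingEnd ℂ z) ^ k‖ +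
            ‖((n : ℂ) * z ^ (n - k) + a * k) * z ^ k‖ := by
          rw [h1]
          exact (norm_sub_le _ _).trans (by gcongr; exact norm_sub_le _ _)
        _ = _ := by
          rw [norm_mul _ (z ^ k), norm_mul, norm_mul, norm_pow, norm_pow, RCLike.norm_conj,
            Complex.norm_natCast, Complex.norm_of_nonneg hb]
    have h3 : ((n : ℝ) - k) * a * ‖z‖ ^ k ≤
        (n + n * b + ‖(n : ℂ) * z ^ (n - k) + a * k‖) * ‖z‖ ^ k := by nlinarith
    have h4 := le_of_mul_le_mul_right h3 (by positivity)
    nlinarith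

/-! ### Counting the zeros -/

open Polynomial in
theorem ncard_zeroSet_zero {n k : ℕ} (hkn : k < n) {a : ℝ}
    (h : ∀ z, harmonicF n k a 0 z = 0 →
      z ∈ sensePreservingRegion (analyticPart n k a) (coanalyticPart k 0)) :
    (zeroSet n k a 0).ncard = n := by
  set p : ℂ[X] := X ^ n + (C (a : ℂ) * X ^ k - 1) with hp
  have hdeg : (C (a : ℂ) * X ^ k - 1 : ℂ[X]).degree < n := by
    refine (degree_sub_le _ _).trans_lt (max_lt ?_ ?_)
    · exact (degree_C_mul_X_pow_le k _).trans_lt (by exact_mod_cast hkn)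
    · exact degree_one_le.trans_lt (by exact_mod_cast (by omega : 0 < n))
  have hmonic : p.Monic := monic_X_pow_add hdeg
  have hnat : p.natDegree = n := by
    rw [natDegree_eq_of_degree_eq_some]
    rw [hp, degree_add_eq_left_of_degree_lt (by simpa using hdeg), degree_X_pow]
  have heval : ∀ z, p.eval z = analyticPart n k a z := by
    intro z; simp [hp, analyticPart]; ring
  have hroot : ∀ z, p.IsRoot z ↔ harmonicF n k a 0 z = 0 := by
    intro z; rw [IsRoot, heval]; simp [harmonicF, analyticPart]
  have hnodup : p.roots.Nodup := by
    classical
    rw [Multiset.nodup_iff_count_le_one]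
    intro z
    rw [count_roots]
    by_contra! hc
    obtain ⟨hr, hd⟩ := (one_lt_rootMultiplicity_iff_isRoot hmonic.ne_zero).1 hc
    have hs := h z ((hroot z).1 hr)
    have hd' : deriv (analyticPart n k a) z = 0 := by
      rw [← funext heval, p.deriv]; exact hd
    have hs : ‖_‖ < ‖_‖ := hs
    rw [hd', norm_zero] at hs
    exact (norm_nonneg _).not_gt hs
  have hset : zeroSet n k a 0 = (p.roots.toFinset : Set ℂ) := by
    ext z
    simp only [Finset.mem_coe, Multiset.mem_toFinset, mem_roots hmonic.ne_zero, hroot]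
    rfl
  rw [hset, Set.ncard_coe_finset, Multiset.toFinset_card_of_nodup hnodup,
    splits_iff_card_roots.1 (IsAlgClosed.splits p), hnat]

open Filter Topology in
theorem zeroSet_finite_and_eventually_ncard_eq {n k : ℕ} (hkn : k < n) {a b : ℝ}
    (h : ∀ z, harmonicF n k a b z = 0 →
      z ∈ sensePreservingRegion (analyticPart n k a) (coanalyticPart k b)) :
    (zeroSet n k a b).Finite ∧
      ∀ᶠ t in 𝓝 b, (zeroSet n k a t).ncard = (zeroSet n k a b).ncard := by
  have hc := contDiff_harmonicF n k a
  refine fiber_finite_and_eventually_ncard_eq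
    (Z := {p : ℝ × ℂ | harmonicF n k a p.1 p.2 = 0}) (isClosed_eq hc.continuous continuous_const)
    b (isCompact_closedBall (0 : ℂ) (|a| + (|b| + 1) + 1)) ?_ ?_
  · have : ∀ᶠ t : ℝ in 𝓝 b, |t| < |b| + 1 :=
      continuous_abs.continuousAt.eventually_lt continuousAt_const (by simp)
    filter_upwards [this] with t ht z hz
    rw [mem_closedBall_zero_iff]
    linarith [norm_le_of_harmonicF_eq_zero hkn hz]
  · intro z hz
    have hz : harmonicF n k a b z = 0 := hz
    have hd := hc.contDiffAt.hasStrictFDerivAt (x := (b, z)) one_ne_zero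
    have hi := isInvertible_of_mem_sensePreservingRegion (h z hz)
    refine ⟨hd.implicitFunctionOfProdDomain hi, hd.tendsto_implicitFunctionOfProdDomain hi, ?_⟩
    simpa only [hz, Set.mem_ofPred_eq] using
      hd.eventually_apply_eq_iff_implicitFunctionOfProdDomain hi

theorem zeroOrder_eq_one {h g : ℂ → ℂ} {z : ℂ} (hz : z ∈ sensePreservingRegion h g) :
    zeroOrder h g z = 1 := by
  have hd : deriv h z ≠ 0 := norm_pos_iff.1 ((norm_nonneg _).trans_lt hz)
  have hmem : 1 ∈ {m : ℕ | 1 ≤ m ∧ iteratedDeriv m h z ≠ 0} := by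
    simpa [iteratedDeriv_one] using hd
  have : sInf {m : ℕ | 1 ≤ m ∧ iteratedDeriv m h z ≠ 0} = 1 :=
    le_antisymm (Nat.sInf_le hmem) (Nat.sInf_mem ⟨1, hmem⟩).1
  rw [zeroOrder, if_pos hz, this, Nat.cast_one]

theorem theorem2 (n k : ℕ) (hk : 1 ≤ k) (hkn : k < n) (ε : ℝ) (hε : 0 < ε) :
    ∃ a₀ : ℝ, ∀ a b : ℝ, a₀ < a → 0 < b →
      b < (((n : ℝ) - (k : ℝ)) / ((n : ℝ) + (k : ℝ)) - ε) * a →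
        (zeroSet n k a b).Finite ∧
        (zeroSet n k a b).ncard = n ∧
        (∑ᶠ z ∈ zeroSet n k a b,
          (zeroOrder (analyticPart n k a) (coanalyticPart k b) z).natAbs) = n ∧
        (∀ z ∈ zeroSet n k a b,
          z ∉ senseReversingRegion (analyticPart n k a) (coanalyticPart k b) ∧
          z ∉ criticalCurve (analyticPart n k a) (coanalyticPart k b)) := by
  refine ⟨n / ε, fun a b ha hb hba => ?_⟩
  have hsp : ∀ t ∈ Set.Icc 0 b, ∀ z, harmonicF n k a t z = 0 →
      z ∈ sensePreservingRegion (analyticPart n k a) (coanalyticPart k t) := fun t ht z hz =>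
    mem_sensePreservingRegion_of_harmonicF_eq_zero hk hkn hε ha ht.1 (ht.2.trans hba.le) hz
  have hbI : b ∈ Set.Icc 0 b := ⟨hb.le, le_rfl⟩
  have h0I : (0 : ℝ) ∈ Set.Icc 0 b := ⟨le_rfl, hb.le⟩
  have hfin := (zeroSet_finite_and_eventually_ncard_eq hkn (hsp b hbI)).1
  have hcard : (zeroSet n k a b).ncard = n := by
    -- A locally constant function, as a continuous map to the discrete space `ℕ`.
    have hcont : ContinuousOn (fun t => (zeroSet n k a t).ncard) (Set.Icc 0 b) := fun t ht =>
      (continuousAt_const.congr (Filter.EventuallyEq.symm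
        (zeroSet_finite_and_eventually_ncard_eq hkn (hsp t ht)).2)).continuousWithinAt
    exact (isPreconnected_Icc.constant hcont hbI h0I).trans (ncard_zeroSet_zero hkn (hsp 0 h0I))
  refine ⟨hfin, hcard, ?_, fun z hz => ?_⟩
  · rw [finsum_mem_congr rfl (g := fun _ => 1) fun z hz => by
      rw [zeroOrder_eq_one (hsp b hbI z hz), Int.natAbs_one],
      finsum_mem_eq_finite_toFinset_sum _ hfin,
      Finset.sum_const, smul_eq_mul, mul_one, ← Set.ncard_eq_toFinset_card _ hfin, hcard]
  · have h : ‖_‖ < ‖_‖ := hsp b hbI z hz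
    exact ⟨h.not_gt, h.ne'⟩
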